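/- Let $A,E\in\mathbb{R}^{n\times n}$, let $j=\sqrt{-1}$, and put $K(z)=(zE-A)^{-1}$. Assume that the matrix pencil $(A,E)$ is regular, and let $\alpha,\beta\in\mathbb{C}$ be any numbers for which $\alpha E+\beta A$ is invertible. Let $\theta_1\in(-\pi,\pi)$, and assume that $\det(A-e^{j\phi}E)\neq 0$ for every $\phi\in\mathbb{R}$ whose wrapped argument $\mathrm{wrap}(\phi)$, that is the principal argument of $e^{j\phi}$ in $(-\pi,\pi]$, lies in $[\theta_1,\pi]$. For $\varepsilon\in\mathbb{C}$ set $$A_\varepsilon=A+\alpha\varepsilon I,\quad E_\varepsilon=E-\beta\varepsilon I,\quad \Phi_+(\varepsilon)=E_\varepsilon+A_\varepsilon,\quad \Phi_-(\varepsilon)=E_\varepsilon-A_\varepsilon,\quad t_1=\tan\tfrac{\theta_1}{2},\quad \eta_f=\log(t_1-j).$$ Here $\log$ is the principal logarithm; for a complex square matrix $M$ without eigenvalues in $(-\infty,0]$, $\log M$ is the unique matrix $Q$ with $e^{Q}=M$ all of whose eigenvalues $\lambda$ satisfy $-\pi<\operatorname{Im}\lambda<\pi$. Then $\theta\mapsto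 K(e^{j\theta})$ is integrable on $[\theta_1,\pi]$; for all sufficiently small $\varepsilon\neq0$ the matrices $A_\varepsilon$ and $\Phi_+(\varepsilon)$ are invertible and the principal logarithms below exist; both limits below (over complex $\varepsilon\to0$, $\varepsilon\ne0$) exist; and $$\int_{\theta_1}^{\pi}K(e^{j\theta})\,d\theta=\lim_{\varepsilon\to0}\frac1j\,A_\varepsilon^{-1}\Big(\eta_f I-\log\big(t_1I-j\,\Phi_-(\varepsilon)\Phi_+(\varepsilon)^{-1}\big)\Big)=\lim_{\varepsilon\to0}\frac1j\Big(\eta_f I-\log\big(t_1I-j\,\Phi_+(\varepsilon)^{-1}\Phi_-(\varepsilon)\big)\Big)A_\varepsilon^{-1}.$$ -/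

import Mathlib

open Filter Topology

noncomputable section

namespace DescriptorIntegral

/-- A real square matrix regarded as a complex one. -/
def toC {n : ℕ} (M : Matrix (Fin n) (Fin n) ℝ) : Matrix (Fin n) (Fin n) ℂ :=
  M.map (fun x : ℝ => (x : ℂ))

/-- The wrapped angle: the principal argument, in `(-π, π]`, of `exp (iθ)`. -/
def wrap (θ : ℝ) : ℝ := Complex.arg (Complex.exp ((θ : ℂ) * Complex.I))

/-- `z` is an eigenvalue of the matrix pencil `(A, E)`, that is `det (A - z E) = 0`. -/
def IsPencilEigenvalue {n : ℕ} (A E : Matrix (Fin n) (Fin n) ℂ) (z : ℂ) : Prop :=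
  (A - z • E).det = 0

/-- `Q` is a principal logarithm of `M`: `exp Q = M`, and every eigenvalue of `Q` lies in the open
strip `-π < Im z < π`. (For `M` without eigenvalues on `(-∞, 0]` there is exactly one such `Q`.) -/
def IsPrincipalLog {n : ℕ} (M Q : Matrix (Fin n) (Fin n) ℂ) : Prop :=
  NormedSpace.exp Q = M ∧ ∀ z ∈ spectrum ℂ Q, -Real.pi < z.im ∧ z.im < Real.pi

open Classical in
/-- The principal logarithm of a complex matrix, with value `0` if there is none. -/
def principalLog {n : ℕ} (M : Matrix (Fin n) (Fin n) ℂ) : Matrix (Fin n) (Fin n) ℂ :=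
  if h : ∃ Q, IsPrincipalLog M Q then h.choose else 0

/-- The principal logarithm of `M` is defined: `M` has no eigenvalue on the closed negative real
axis, and exactly one matrix is a principal logarithm of `M`. -/
def HasPrincipalLog {n : ℕ} (M : Matrix (Fin n) (Fin n) ℂ) : Prop :=
  (∀ z ∈ spectrum ℂ M, ¬ (z.im = 0 ∧ z.re ≤ 0)) ∧ ∃! Q, IsPrincipalLog M Q

/-- The system `K(z) = (z E - A)⁻¹`. -/
def transfer {n : ℕ} (A E : Matrix (Fin n) (Fin n) ℝ) (z : ℂ) : Matrix (Fin n) (Fin n) ℂ :=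
  (z • toC E - toC A)⁻¹

/-- `A_ε = A + α ε I`. -/
def Aeps {n : ℕ} (A : Matrix (Fin n) (Fin n) ℝ) (α ε : ℂ) : Matrix (Fin n) (Fin n) ℂ :=
  toC A + (α * ε) • (1 : Matrix (Fin n) (Fin n) ℂ)

/-- `E_ε = E - β ε I`. -/
def Eeps {n : ℕ} (E : Matrix (Fin n) (Fin n) ℝ) (β ε : ℂ) : Matrix (Fin n) (Fin n) ℂ :=
  toC E - (β * ε) • (1 : Matrix (Fin n) (Fin n) ℂ)

/-- `Φ₊(ε) = E_ε + A_ε`. -/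
def PhiPlus {n : ℕ} (A E : Matrix (Fin n) (Fin n) ℝ) (α β ε : ℂ) :
    Matrix (Fin n) (Fin n) ℂ :=
  Eeps E β ε + Aeps A α ε

/-- `Φ₋(ε) = E_ε - A_ε`. -/
def PhiMinus {n : ℕ} (A E : Matrix (Fin n) (Fin n) ℝ) (α β ε : ℂ) :
    Matrix (Fin n) (Fin n) ℂ :=
  Eeps E β ε - Aeps A α ε

/-- `t₁ I - i Φ₋(ε) Φ₊(ε)⁻¹`, with `t₁ = tan (θ₁ / 2)`. -/
def logArgL {n : ℕ} (A E : Matrix (Fin n) (Fin n) ℝ) (α β : ℂ) (θ₁ : ℝ) (ε : ℂ) :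
    Matrix (Fin n) (Fin n) ℂ :=
  (Real.tan (θ₁ / 2) : ℂ) • (1 : Matrix (Fin n) (Fin n) ℂ) -
    Complex.I • (PhiMinus A E α β ε * (PhiPlus A E α β ε)⁻¹)

/-- `t₁ I - i Φ₊(ε)⁻¹ Φ₋(ε)`, with `t₁ = tan (θ₁ / 2)`. -/
def logArgR {n : ℕ} (A E : Matrix (Fin n) (Fin n) ℝ) (α β : ℂ) (θ₁ : ℝ) (ε : ℂ) :
    Matrix (Fin n) (Fin n) ℂ :=
  (Real.tan (θ₁ / 2) : ℂ) • (1 : Matrix (Fin n) (Fin n) ℂ) -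
    Complex.I • ((PhiPlus A E α β ε)⁻¹ * PhiMinus A E α β ε)

/-- `η_f = log (t₁ - i)`, with `t₁ = tan (θ₁ / 2)`. -/
def etaF (θ₁ : ℝ) : ℂ := Complex.log ((Real.tan (θ₁ / 2) : ℂ) - Complex.I)

/-- The integral of `K (exp (iθ))` over `[θ₁, π]`, taken entry by entry. -/
def transferIntegral {n : ℕ} (A E : Matrix (Fin n) (Fin n) ℝ) (θ₁ : ℝ) :
    Matrix (Fin n) (Fin n) ℂ :=
  Matrix.of fun k l => ∫ θ in θ₁..Real.pi, transfer A E (Complex.exp ((θ : ℂ) * Complex.I)) k l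

end DescriptorIntegral

end

/-! For small `ε ≠ 0` both formulas hold exactly; the limit only removes the perturbation. Write `X
= A_ε`, `Y = E_ε`, `B = X (Y + X)⁻¹`. Then `e^{iθ} Y - X = e^{iθ} F(θ) (Y + X)` with `F(θ) = 1 - (1
+ e^{-iθ}) B`, so `X (e^{iθ} Y - X)⁻¹` is `-i` times the logarithmic derivative of `F`. As `F(π) =
1`, this gives `exp (-i ∫_θ^π X (e^{is} Y - X)⁻¹ ds) = F(θ)` (`exp_integral_arcIntegrand`). Since
`(t₁ - i) F(θ₁) = t₁ - i (1 - 2 B)`, the matrix `η_f - i ∫` is a logarithm of the argument in the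
theorem. The second formula uses `(Y + X)⁻¹ X` instead.

That this logarithm is principal is checked on common eigenvectors, where it becomes a scalar
statement: the imaginary part is below `π` in modulus near `θ = π`, and by continuity it cannot
reach `±π`, because the exponential avoids the negative axis (`abs_im_log_add_integral_lt`).
Uniqueness is `IsPrincipalLog.eq_of_commute`. Finally the integral of the inverse pencil is
continuous at `ε = 0` by dominated convergence. -/

noncomputable section

namespace DescriptorIntegral

/-! ### Integrating a logarithmic derivative in a Banach algebra. -/

section BanachAlgebra

variable {𝔸 : Type*} [NormedRing 𝔸] [NormedAlgebra ℂ 𝔸]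

/-- Commutativity gives `exp (f s) = exp (f t) * exp (f s - f t)`, so only the derivative of `exp`
at `0` is needed. -/
theorem hasDerivAt_exp_of_commute [CompleteSpace 𝔸] {f : ℝ → 𝔸} {f' : 𝔸} {t : ℝ}
    (hc : ∀ s, Commute (f s) (f t)) (hf : HasDerivAt f f' t) :
    HasDerivAt (fun s => NormedSpace.exp (f s)) (NormedSpace.exp (f t) * f') t := by
  let _ : NormedAlgebra ℚ 𝔸 := NormedAlgebra.restrictScalars ℚ ℂ 𝔸
  have h0 : HasFDerivAt (NormedSpace.exp : 𝔸 → 𝔸) (1 : 𝔸 →L[ℝ] 𝔸) (f t - f t) := by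
    rw [sub_self]; exact hasFDerivAt_exp_zero
  have h1 : HasDerivAt (fun s => NormedSpace.exp (f s - f t)) f' t :=
    h0.comp_hasDerivAt_of_eq t (hf.sub_const (f t)) rfl
  have h2 := h1.const_mul (NormedSpace.exp (f t))
  refine h2.congr_of_eventuallyEq (Eventually.of_forall fun s => ?_)
  have : Commute (f t) (f s - f t) := ((hc s).symm).sub_right (Commute.refl _)
  simp only [← NormedSpace.exp_add_of_commute this, add_sub_cancel]

/-- The factor `1 - (1 + e^{-iθ}) B`; it equals `e^{-iθ} (e^{iθ} (1 - B) - B)`. -/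
def arcFactor (B : 𝔸) (θ : ℝ) : 𝔸 :=
  1 - (1 + Complex.exp (-(θ * Complex.I))) • B

/-- `i` times this is the logarithmic derivative of `arcFactor B`. -/
def arcIntegrand (B : 𝔸) (θ : ℝ) : 𝔸 :=
  Complex.exp (-(θ * Complex.I)) • (B * Ring.inverse (arcFactor B θ))

theorem hasDerivAt_arcFactor (B : 𝔸) (θ : ℝ) :
    HasDerivAt (arcFactor B) ((Complex.I * Complex.exp (-(θ * Complex.I))) • B) θ := by
  have h1 : HasDerivAt (fun s : ℝ => Complex.exp (-(s * Complex.I)))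
      (Complex.exp (-(θ * Complex.I)) * (-(1 * Complex.I))) θ :=
    (((Complex.ofRealCLM.hasDerivAt (x := θ)).mul_const Complex.I).neg).cexp
  have h2 := ((h1.const_add 1).smul_const B).const_sub 1
  refine h2.congr_deriv ?_
  rw [← neg_smul]; congr 1; ring

theorem continuous_arcFactor (B : 𝔸) : Continuous (arcFactor B) :=
  continuous_iff_continuousAt.2 fun θ => (hasDerivAt_arcFactor B θ).continuousAt

theorem continuousOn_arcIntegrand [CompleteSpace 𝔸] {B : 𝔸} {s : Set ℝ} (h : ∀ θ ∈ s, IsUnit (arcFactor B θ)) :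
    ContinuousOn (arcIntegrand B) s := by
  intro θ hθ
  refine ContinuousAt.continuousWithinAt ?_
  have h1 : ContinuousAt (fun θ : ℝ => Complex.exp (-(θ * Complex.I))) θ := by fun_prop
  obtain ⟨u, hu⟩ := h θ hθ
  have h2 : ContinuousAt (fun θ => Ring.inverse (arcFactor B θ)) θ := by
    refine ContinuousAt.comp (g := Ring.inverse) ?_ (continuous_arcFactor B).continuousAt
    rw [← hu]; exact NormedRing.inverse_continuousAt u
  exact h1.smul (continuousAt_const.mul h2)

theorem commute_arcFactor {B C : 𝔸} (h : Commute C B) (θ : ℝ) : Commute C (arcFactor B θ) :=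
  (Commute.one_right C).sub_right (h.smul_right _)

theorem _root_.Commute.ring_inverse_right {M : Type*} [MonoidWithZero M] {a b : M} (h : Commute a b) :
    Commute a (Ring.inverse b) := by
  by_cases hb : IsUnit b
  · obtain ⟨u, rfl⟩ := hb
    rw [Ring.inverse_unit]
    exact h.units_inv_right
  · rw [Ring.inverse_non_unit _ hb]
    exact Commute.zero_right a

theorem commute_arcIntegrand {B C : 𝔸} (h : Commute C B) (θ : ℝ) :
    Commute C (arcIntegrand B θ) :=
  (h.mul_right (commute_arcFactor h θ).ring_inverse_right).smul_right _

theorem commute_intervalIntegral [CompleteSpace 𝔸] {f : ℝ → 𝔸} {C : 𝔸} {a b : ℝ}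
    (hf : IntervalIntegrable f MeasureTheory.volume a b) (h : ∀ θ, Commute C (f θ)) :
    Commute C (∫ θ in a..b, f θ) := by
  have h1 := (ContinuousLinearMap.mul ℝ 𝔸 C).intervalIntegral_comp_comm hf
  have h2 := ((ContinuousLinearMap.mul ℝ 𝔸).flip C).intervalIntegral_comp_comm hf
  simp only [ContinuousLinearMap.mul_apply', ContinuousLinearMap.flip_apply] at h1 h2
  rw [Commute, SemiconjBy, ← h1, ← h2]
  congr 1; ext θ; exact (h θ).eq

/-- With `P t = -i ∫_b^t`, the product `exp (P t) * arcFactor B t` has zero derivative, all factors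
commuting, and equals `1` at `t = b`. -/
theorem exp_integral_arcIntegrand [CompleteSpace 𝔸] {B : 𝔸} {a b : ℝ} (hab : a ≤ b)
    (hb : arcFactor B b = 1)
    (h : ∀ θ ∈ Set.Icc a b, IsUnit (arcFactor B θ)) {θ : ℝ} (hθ : θ ∈ Set.Icc a b) :
    NormedSpace.exp ((-Complex.I) • ∫ s in θ..b, arcIntegrand B s) = arcFactor B θ := by
  let _ : NormedAlgebra ℚ 𝔸 := NormedAlgebra.restrictScalars ℚ ℂ 𝔸
  -- The continuous extension off `[a, b]` makes the primitive two-sidedly differentiable at the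
  -- endpoints too.
  set D : ℝ → 𝔸 := Set.IccExtend hab (fun s : Set.Icc a b => arcIntegrand B s) with hD
  have hDc : Continuous D :=
    (continuousOn_iff_continuous_domRestrict.1 (continuousOn_arcIntegrand h)).Icc_extend'
  have hDeq : ∀ s ∈ Set.Icc a b, D s = arcIntegrand B s := fun s hs =>
    Set.IccExtend_of_mem hab _ hs
  set P : ℝ → 𝔸 := fun t => (-Complex.I) • ∫ s in b..t, D s with hP
  have hcomm : ∀ C, Commute C B → ∀ t, Commute C (P t) := fun C hC t =>
    (commute_intervalIntegral (hDc.intervalIntegrable _ _)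
      (fun s => commute_arcIntegrand hC _)).smul_right _
  have hPP : ∀ s t, Commute (P s) (P t) := fun s t =>
    hcomm _ (hcomm B (Commute.refl B) s).symm t
  have hder : ∀ t ∈ Set.Icc a b,
      HasDerivAt (fun t => NormedSpace.exp (P t) * arcFactor B t) 0 t := by
    intro t ht
    have h1 : HasDerivAt P ((-Complex.I) • D t) t :=
      (hDc.integral_hasStrictDerivAt b t).hasDerivAt.fun_const_smul (-Complex.I)
    have h2 := (hasDerivAt_exp_of_commute (fun s => hPP s t) h1).mul (hasDerivAt_arcFactor B t)
    refine h2.congr_deriv ?_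
    rw [hDeq t ht, mul_assoc, ← mul_add, arcIntegrand, smul_mul_assoc, smul_mul_assoc, mul_assoc,
      Ring.inverse_mul_cancel _ (h t ht), mul_one, smul_smul, ← add_smul]
    simp
  have hconst := constant_of_has_deriv_right_zero
    (f := fun t => NormedSpace.exp (P t) * arcFactor B t) (a := a) (b := b)
    (fun t ht => (hder t ht).continuousAt.continuousWithinAt)
    (fun t ht => (hder t (Set.Ico_subset_Icc_self ht)).hasDerivWithinAt)
  have e : NormedSpace.exp (P θ) * arcFactor B θ = 1 := by
    have h1 := hconst θ hθ
    have h2 := hconst b (Set.right_mem_Icc.2 hab)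
    have h3 : P b = 0 := by simp [hP]
    rw [h1, ← h2, hb, h3, NormedSpace.exp_zero, mul_one]
  have e2 : (-Complex.I) • ∫ s in θ..b, arcIntegrand B s = - P θ := by
    rw [hP]
    simp only
    rw [intervalIntegral.integral_symm b θ, ← smul_neg]
    congr 1
    rw [neg_inj]
    refine intervalIntegral.integral_congr fun s hs => ?_
    rw [Set.uIcc_of_ge hθ.2] at hs
    exact (hDeq s ⟨hθ.1.trans hs.1, hs.2⟩).symm
  rw [e2]
  calc NormedSpace.exp (-P θ) = NormedSpace.exp (-P θ) * (NormedSpace.exp (P θ) * arcFactor B θ) := by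
        rw [e, mul_one]
    _ = arcFactor B θ := by
        rw [← mul_assoc, ← NormedSpace.exp_add_of_commute ((Commute.refl (P θ)).neg_left),
          neg_add_cancel, NormedSpace.exp_zero, one_mul]

end BanachAlgebra

/-! ### Common eigenvectors and uniqueness of principal logarithms. -/

open Matrix in
theorem exists_common_eigenvector {n : ℕ} {X Y : Matrix (Fin n) (Fin n) ℂ} (h : Commute X Y)
    {l : ℂ} (hl : l ∈ spectrum ℂ X) :
    ∃ v : Fin n → ℂ, v ≠ 0 ∧ X *ᵥ v = l • v ∧ ∃ μ : ℂ, Y *ᵥ v = μ • v := by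
  rw [← Matrix.spectrum_toLin', ← Module.End.hasEigenvalue_iff_mem_spectrum] at hl
  have hc : Commute (Matrix.toLin' X) (Matrix.toLin' Y) := by
    rw [Commute, SemiconjBy, Module.End.mul_eq_comp, Module.End.mul_eq_comp, ← Matrix.toLin'_mul,
      ← Matrix.toLin'_mul, h.eq]
  have hm : Set.MapsTo (Matrix.toLin' Y) (Module.End.eigenspace (Matrix.toLin' X) l)
      (Module.End.eigenspace (Matrix.toLin' X) l) :=
    Module.End.mapsTo_genEigenspace_of_comm hc l 1
  have : Nontrivial (Module.End.eigenspace (Matrix.toLin' X) l) :=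
    Submodule.nontrivial_iff_ne_bot.2 hl
  obtain ⟨μ, hμ⟩ := Module.End.exists_eigenvalue ((Matrix.toLin' Y).restrict hm)
  obtain ⟨w, hw⟩ := hμ.exists_hasEigenvector
  refine ⟨w, fun h0 => hw.2 (Subtype.ext h0), ?_, μ, ?_⟩
  · simpa using Module.End.mem_eigenspace_iff.1 w.2
  · exact congrArg Subtype.val hw.apply_eq_smul

section LinftyNorm

attribute [local instance] Matrix.linftyOpNormedRing Matrix.linftyOpNormedAlgebra

open Matrix

theorem exp_mulVec_of_eigenvector {n : ℕ} {X : Matrix (Fin n) (Fin n) ℂ} {v : Fin n → ℂ} {l : ℂ}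
    (h : X *ᵥ v = l • v) : NormedSpace.exp X *ᵥ v = Complex.exp l • v := by
  have hp : ∀ k : ℕ, X ^ k *ᵥ v = l ^ k • v := by
    intro k
    induction k with
    | zero => simp
    | succ k ih => rw [pow_succ, ← Matrix.mulVec_mulVec, h, Matrix.mulVec_smul, ih, smul_smul,
        pow_succ, mul_comm]
  have h1 := (NormedSpace.exp_series_hasSum_exp' (𝕂 := ℂ) X).map
    (Matrix.mulVecBilin ℂ ℂ |>.flip v).toAddMonoidHom
    (LinearMap.continuous_of_finiteDimensional (Matrix.mulVecBilin ℂ ℂ |>.flip v))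
  have h2 := (NormedSpace.exp_series_hasSum_exp' (𝕂 := ℂ) l).smul_const v
  rw [← Complex.exp_eq_exp_ℂ] at h2
  refine h1.unique (h2.congr_fun fun k => ?_)
  simp [hp, smul_smul]

/-- The series of `exp N * X` stops after its linear term, leaving `X = X + N * X`. This lowers the
nilpotency order by one. -/
theorem mul_eq_zero_of_exp_eq_one {n : ℕ} {N X : Matrix (Fin n) (Fin n) ℂ}
    (hN : NormedSpace.exp N = 1) (h : N * (N * X) = 0) : N * X = 0 := by
  have h1 := (NormedSpace.exp_series_hasSum_exp' (𝕂 := ℂ) N).mul_right X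
  have h2 : HasSum (fun k : ℕ => ((k.factorial : ℂ)⁻¹ • N ^ k) * X)
      (∑ k ∈ Finset.range 2, ((k.factorial : ℂ)⁻¹ • N ^ k) * X) := by
    refine hasSum_sum_of_ne_finset_zero fun k hk => ?_
    obtain ⟨m, rfl⟩ := Nat.exists_eq_add_of_le' (not_lt.1 (fun h => hk (Finset.mem_range.2 h)))
    rw [pow_add, pow_two, smul_mul_assoc, mul_assoc, mul_assoc, h, mul_zero, smul_zero]
  have h3 : NormedSpace.exp N * X = _ := h1.unique h2
  rw [hN] at h3
  simpa [Finset.sum_range_succ] using h3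

theorem pow_card_eq_zero_of_spectrum {n : ℕ} {N : Matrix (Fin n) (Fin n) ℂ}
    (h : ∀ z ∈ spectrum ℂ N, z = 0) : N ^ n = 0 := by
  have hr : N.charpoly.roots = Multiset.replicate n 0 := by
    rw [Multiset.eq_replicate]
    refine ⟨?_, fun z hz => h z ?_⟩
    · rw [← (IsAlgClosed.splits N.charpoly).natDegree_eq_card_roots,
        Matrix.charpoly_natDegree_eq_dim, Fintype.card_fin]
    · exact Matrix.mem_spectrum_iff_isRoot_charpoly.2 (Polynomial.isRoot_of_mem_roots hz)
  have hc : N.charpoly = Polynomial.X ^ n := by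
    rw [(IsAlgClosed.splits N.charpoly).eq_prod_roots, hr, N.charpoly_monic.leadingCoeff]
    simp
  have := Matrix.aeval_self_charpoly N
  rwa [hc, map_pow, Polynomial.aeval_X] at this

theorem eq_zero_of_exp_eq_one {n : ℕ} {N : Matrix (Fin n) (Fin n) ℂ}
    (hN : NormedSpace.exp N = 1) (h : ∀ z ∈ spectrum ℂ N, z = 0) : N = 0 := by
  have key : ∀ m : ℕ, N ^ (m + 1) = 0 → N = 0 := by
    intro m
    induction m with
    | zero => intro h; simpa using h
    | succ m ih =>
      intro h
      refine ih ?_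
      rw [pow_succ']
      refine mul_eq_zero_of_exp_eq_one hN ?_
      rw [← h, pow_succ', pow_succ']
  exact key n (by rw [pow_succ, pow_card_eq_zero_of_spectrum h, zero_mul])

/-- `exp (Q - Q') = 1`, so eigenvalues of `Q - Q'` lie in `2πiℤ`. On a common eigenvector such an
eigenvalue is a difference of two points of the open strip, hence `0`. Thus `Q - Q'` is nilpotent
with exponential `1`, which forces it to vanish. -/
theorem IsPrincipalLog.eq_of_commute {n : ℕ} {M Q Q' : Matrix (Fin n) (Fin n) ℂ}
    (hQ : IsPrincipalLog M Q) (hQ' : IsPrincipalLog M Q') (hc : Commute Q Q') : Q = Q' := by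
  have hexp : NormedSpace.exp (Q - Q') = 1 := by
    have h1 : NormedSpace.exp Q = NormedSpace.exp (Q - Q') * NormedSpace.exp Q' := by
      rw [← Matrix.exp_add_of_commute _ _ (hc.sub_left (Commute.refl _)), sub_add_cancel]
    rw [hQ.1, ← hQ'.1] at h1
    have h2 := Matrix.isUnit_exp Q'
    exact (h2.mul_eq_right.1 h1.symm)
  refine sub_eq_zero.1 (eq_zero_of_exp_eq_one hexp fun z hz => ?_)
  obtain ⟨v, hv, hz, μ, hμ⟩ := exists_common_eigenvector
    (show Commute (Q - Q') Q' from hc.sub_left (Commute.refl _)) hz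
  have hQv : Q *ᵥ v = (z + μ) • v := by
    rw [add_smul, ← hz, ← hμ, ← Matrix.add_mulVec, sub_add_cancel]
  have mem : ∀ {X : Matrix (Fin n) (Fin n) ℂ} {l : ℂ}, X *ᵥ v = l • v → l ∈ spectrum ℂ X := by
    intro X l h
    rw [← Matrix.spectrum_toLin', ← Module.End.hasEigenvalue_iff_mem_spectrum]
    exact Module.End.hasEigenvalue_of_hasEigenvector
      ⟨Module.End.mem_eigenspace_iff.2 (by simpa using h), hv⟩
  have h1 := hQ.2 _ (mem hQv)
  have h2 := hQ'.2 _ (mem hμ)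
  have h3 := exp_mulVec_of_eigenvector hz
  rw [hexp, Matrix.one_mulVec] at h3
  have h4 : Complex.exp z = 1 := by
    have : (1 - Complex.exp z) • v = 0 := by rw [sub_smul, one_smul, ← h3, sub_self]
    exact (sub_eq_zero.1 ((smul_eq_zero.1 this).resolve_right hv)).symm
  obtain ⟨k, hk⟩ := Complex.exp_eq_one_iff.1 h4
  have h5 : z.im = k * (2 * Real.pi) := by rw [hk]; simp
  rw [Complex.add_im] at h1
  have hpi := Real.pi_pos
  have k1 : (k : ℝ) < 1 := by nlinarith
  have k2 : (-1 : ℝ) < k := by nlinarith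
  have k3 : k = 0 := by
    have : k < 1 := by exact_mod_cast k1
    have : -1 < k := by exact_mod_cast k2
    omega
  rw [hk, k3]; simp

end LinftyNorm

/-! ### The scalar case: the half-angle substitution and the branch of the logarithm. -/

theorem ofReal_sub_I_ne_zero (x : ℝ) : (x : ℂ) - Complex.I ≠ 0 := fun h => by
  simpa using congrArg Complex.im h

theorem cos_half_pos {θ : ℝ} (h : θ ∈ Set.Ioo (-Real.pi) Real.pi) : 0 < Real.cos (θ / 2) :=
  Real.cos_pos_of_mem_Ioo ⟨by linarith [h.1], by linarith [h.2]⟩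

/-- The factors are `-i e^{iθ/2} / cos (θ/2)` and `2 cos (θ/2) e^{-iθ/2}`. -/
theorem tan_sub_I_mul {θ : ℝ} (h : θ ∈ Set.Ioo (-Real.pi) Real.pi) :
    ((Real.tan (θ / 2) : ℂ) - Complex.I) * (1 + Complex.exp (-(θ * Complex.I))) =
      -(2 * Complex.I) := by
  have hc : (Real.cos (θ / 2) : ℂ) ≠ 0 := by exact_mod_cast (cos_half_pos h).ne'
  have he : Complex.exp (-(θ * Complex.I)) =
      ((Real.cos (θ / 2) : ℂ) - Real.sin (θ / 2) * Complex.I) ^ 2 := by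
    have h1 : -((θ : ℂ) * Complex.I) = (2 : ℕ) * (((-(θ / 2) : ℝ) : ℂ) * Complex.I) := by
      push_cast; ring
    rw [h1, Complex.exp_nat_mul, Complex.exp_mul_I, ← Complex.ofReal_cos, ← Complex.ofReal_sin,
      Real.cos_neg, Real.sin_neg]
    push_cast; ring
  have hs : (Real.sin (θ / 2) : ℂ) ^ 2 = 1 - (Real.cos (θ / 2) : ℂ) ^ 2 := by
    have := Real.sin_sq (θ / 2)
    exact_mod_cast this
  rw [he, Real.tan_eq_sin_div_cos, Complex.ofReal_div]
  field_simp
  set c := (Real.cos (θ / 2) : ℂ)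
  set s := (Real.sin (θ / 2) : ℂ)
  have hI := Complex.I_sq
  have hI3 : Complex.I ^ 3 = -Complex.I := Complex.I_pow_three
  ring_nf
  simp only [hI, hI3]
  linear_combination (-s - c * Complex.I) * hs

theorem tan_sub_I_smul_arcFactor {𝔸 : Type*} [NormedRing 𝔸] [NormedAlgebra ℂ 𝔸] (B : 𝔸) {θ : ℝ}
    (h : θ ∈ Set.Ioo (-Real.pi) Real.pi) :
    ((Real.tan (θ / 2) : ℂ) - Complex.I) • arcFactor B θ =
      (Real.tan (θ / 2) : ℂ) • (1 : 𝔸) - Complex.I • (1 - (2 : ℂ) • B) := by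
  rw [arcFactor, smul_sub, smul_smul, tan_sub_I_mul h]
  module

theorem arcFactor_pi {𝔸 : Type*} [NormedRing 𝔸] [NormedAlgebra ℂ 𝔸] (B : 𝔸) :
    arcFactor B Real.pi = 1 := by
  simp [arcFactor, Complex.exp_neg]

/-- If the value were a real `m ≤ 0`, then `tan (θ/2) - m = tan (φ/2)` for some `φ ∈ [θ, π)`, and
`arcFactor b φ` would vanish. -/
theorem logArg_mem_slitPlane {b : ℂ} {θ₁ : ℝ} (hθ₁ : -Real.pi < θ₁)
    (h : ∀ θ ∈ Set.Icc θ₁ Real.pi, arcFactor b θ ≠ 0) {θ : ℝ} (hθ : θ ∈ Set.Ico θ₁ Real.pi) :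
    (Real.tan (θ / 2) : ℂ) - Complex.I * (1 - 2 * b) ∈ Complex.slitPlane := by
  rw [Complex.mem_slitPlane_iff_not_le_zero]
  intro hle
  obtain ⟨hre, him⟩ := Complex.le_def.1 hle
  set m := (Real.tan (θ / 2) : ℂ) - Complex.I * (1 - 2 * b) with hm
  set φ : ℝ := 2 * Real.arctan (Real.tan (θ / 2) - m.re) with hφ
  have htan : Real.tan (φ / 2) = Real.tan (θ / 2) - m.re := by
    rw [hφ, mul_div_cancel_left₀ _ two_ne_zero, Real.tan_arctan]
  have hφ1 : θ ≤ φ := by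
    have h1 : Real.arctan (Real.tan (θ / 2)) ≤ Real.arctan (Real.tan (θ / 2) - m.re) :=
      Real.arctan_mono (by simp at hre; linarith)
    rw [Real.arctan_tan (by linarith [hθ.1]) (by linarith [hθ.2])] at h1
    rw [hφ]; linarith
  have hφ2 : φ < Real.pi := by
    have := Real.arctan_lt_pi_div_two (Real.tan (θ / 2) - m.re)
    rw [hφ]; linarith
  have hφm : φ ∈ Set.Icc θ₁ Real.pi := ⟨hθ.1.trans hφ1, hφ2.le⟩
  have h2 := tan_sub_I_smul_arcFactor b (θ := φ) ⟨by linarith [hφm.1], hφ2⟩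
  have h3 : (Real.tan (φ / 2) : ℂ) • (1 : ℂ) - Complex.I • (1 - (2 : ℂ) • b) = 0 := by
    have hmre : m = (m.re : ℂ) := Complex.ext (by simp) (by simpa using him)
    rw [htan]
    simp only [smul_eq_mul, mul_one]
    rw [Complex.ofReal_sub, ← hmre, hm]; ring
  rw [h3, smul_eq_mul] at h2
  rcases mul_eq_zero.1 h2 with h4 | h4
  · exact ofReal_sub_I_ne_zero _ h4
  · exact h φ hφm h4

theorem abs_im_lt_pi_of_ne {f : ℝ → ℝ} {a b c : ℝ} (hab : a ≤ b) (hf : ContinuousOn f (Set.Icc a b))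
    (hb : |f b| < c) (h : ∀ x ∈ Set.Icc a b, |f x| ≠ c) : |f a| < c := by
  by_contra hlt
  obtain ⟨x, hx, hxc⟩ := intermediate_value_Icc' hab hf.abs ⟨hb.le, not_lt.1 hlt⟩
  exact h x hx hxc

/-- Continuity is run downwards from some `t < π`, not from `π` itself, where `tan (t/2)` blows up.
A first contact with `±π` would put the exponential on the negative real axis, against
`logArg_mem_slitPlane`. -/
theorem abs_im_log_add_integral_lt {b : ℂ} {θ₁ : ℝ} (hθ₁ : θ₁ ∈ Set.Ioo (-Real.pi) Real.pi)
    (h : ∀ θ ∈ Set.Icc θ₁ Real.pi, arcFactor b θ ≠ 0) :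
    |(etaF θ₁ + (-Complex.I) • ∫ θ in θ₁..Real.pi, arcIntegrand b θ).im| < Real.pi := by
  set P : ℝ → ℂ := fun t => (-Complex.I) • ∫ θ in t..Real.pi, arcIntegrand b θ with hP
  have hcont : ContinuousOn (arcIntegrand b) (Set.Icc θ₁ Real.pi) :=
    continuousOn_arcIntegrand fun θ hθ => isUnit_iff_ne_zero.2 (h θ hθ)
  have hPc : ContinuousOn P (Set.Icc θ₁ Real.pi) := by
    have := intervalIntegral.continuousOn_primitive_interval_left
      (μ := MeasureTheory.volume) (f := arcIntegrand b) (a := θ₁) (b := Real.pi)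
      (by rw [Set.uIcc_of_le hθ₁.2.le]; exact hcont.integrableOn_Icc)
    rw [Set.uIcc_of_le hθ₁.2.le] at this
    exact this.const_smul (-Complex.I)
  have hPpi : P Real.pi = 0 := by simp [hP]
  have hlog : ContinuousOn etaF (Set.Ico θ₁ Real.pi) := by
    intro t ht
    have hc : Real.cos (t / 2) ≠ 0 :=
      (cos_half_pos ⟨hθ₁.1.trans_le ht.1, ht.2⟩).ne'
    have h1 : ContinuousAt (fun t : ℝ => Real.tan (t / 2)) t :=
      (Real.continuousAt_tan.2 hc).comp (f := fun t : ℝ => t / 2) (by fun_prop)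
    have h2 : ContinuousAt (fun t : ℝ => (Real.tan (t / 2) : ℂ) - Complex.I) t :=
      (Complex.continuous_ofReal.continuousAt.comp h1).sub continuousAt_const
    refine (h2.clog (Or.inr ?_)).continuousWithinAt
    rw [Complex.sub_im, Complex.ofReal_im, Complex.I_im]
    norm_num
  -- Near `π` the quantity has small imaginary part.
  obtain ⟨t, ht1, ht0, htpi, htP⟩ : ∃ t, θ₁ ≤ t ∧ 0 < t ∧ t < Real.pi ∧ |(P t).im| < Real.pi / 2 := by
    have h1 : ContinuousWithinAt (fun t => |(P t).im|) (Set.Ico θ₁ Real.pi) Real.pi :=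
      (Complex.continuous_im.abs.continuousAt (x := P Real.pi)).comp_continuousWithinAt
        ((hPc Real.pi ⟨hθ₁.2.le, le_rfl⟩).mono Set.Ico_subset_Icc_self)
    have h2 : ∀ᶠ t in 𝓝[Set.Ico θ₁ Real.pi] Real.pi, |(P t).im| < Real.pi / 2 := by
      refine h1.eventually_lt continuousWithinAt_const ?_
      simp [hPpi, Real.pi_pos]
    have h3 : ∀ᶠ t in 𝓝[Set.Ico θ₁ Real.pi] Real.pi, (0 : ℝ) < t :=
      eventually_nhdsWithin_of_eventually_nhds (lt_mem_nhds Real.pi_pos)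
    have : (𝓝[Set.Ico θ₁ Real.pi] Real.pi).NeBot := by
      rw [← mem_closure_iff_nhdsWithin_neBot, closure_Ico hθ₁.2.ne]
      exact ⟨hθ₁.2.le, le_rfl⟩
    obtain ⟨t, ⟨ha, hb⟩, hc⟩ := ((h2.and h3).and self_mem_nhdsWithin).exists
    exact ⟨t, hc.1, hb, hc.2, ha⟩
  refine abs_im_lt_pi_of_ne (f := fun t => (etaF t + P t).im) ht1 ?_ ?_ ?_
  · exact Complex.continuous_im.comp_continuousOn
      ((hlog.mono fun x hx => ⟨hx.1, hx.2.trans_lt htpi⟩).add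
        (hPc.mono (Set.Icc_subset_Icc_right htpi.le)))
  -- Positivity of `t` puts `tan (t/2) - i` in the right half-plane; its argument and `(P t).im` are
  -- then each below `π/2` in modulus.
  · have htan : 0 < Real.tan (t / 2) :=
      Real.tan_pos_of_pos_of_lt_pi_div_two (by linarith) (by linarith)
    have harg : |(etaF t).im| < Real.pi / 2 := by
      rw [etaF, Complex.log_im]
      refine Complex.abs_arg_lt_pi_div_two_iff.2 (Or.inl ?_)
      rwa [Complex.sub_re, Complex.ofReal_re, Complex.I_re, sub_zero]
    simp only [Complex.add_im]
    calc _ ≤ |(etaF t).im| + |(P t).im| := abs_add_le _ _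
      _ < Real.pi := by linarith
  · intro x hx habs
    have hxI : x ∈ Set.Ico θ₁ Real.pi := ⟨hx.1, hx.2.trans_lt htpi⟩
    have hxO : x ∈ Set.Ioo (-Real.pi) Real.pi := ⟨hθ₁.1.trans_le hx.1, hxI.2⟩
    have hexp : Complex.exp (etaF x + P x) =
        (Real.tan (x / 2) : ℂ) - Complex.I * (1 - 2 * b) := by
      have h1 := exp_integral_arcIntegrand hθ₁.2.le (arcFactor_pi b)
        (fun θ hθ => isUnit_iff_ne_zero.2 (h θ hθ)) (Set.Ico_subset_Icc_self hxI)
      rw [← Complex.exp_eq_exp_ℂ] at h1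
      have h2 := tan_sub_I_smul_arcFactor b hxO
      simp only [smul_eq_mul, mul_one] at h2
      rw [Complex.exp_add, ← h2, hP, h1, etaF, Complex.exp_log (ofReal_sub_I_ne_zero _)]
    have hslit := logArg_mem_slitPlane hθ₁.1 h hxI
    rw [← hexp, Complex.mem_slitPlane_iff, Complex.exp_re, Complex.exp_im] at hslit
    have hc : Real.cos (etaF x + P x).im = -1 := by
      rw [← Real.cos_abs, habs, Real.cos_pi]
    have hs : Real.sin (etaF x + P x).im = 0 := by
      rcases abs_eq Real.pi_pos.le |>.1 habs with h | h <;> rw [h] <;> simp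
    rw [hc, hs] at hslit
    rcases hslit with h | h
    · linarith [Real.exp_pos (etaF x + P x).re]
    · simp at h

/-! ### The principal logarithm of a matrix as an integral. -/

theorem intervalIntegrable_arcIntegrand {𝔸 : Type*} [NormedRing 𝔸] [NormedAlgebra ℂ 𝔸]
    [CompleteSpace 𝔸] {B : 𝔸} {θ₁ : ℝ} (hθ₁ : θ₁ ≤ Real.pi)
    (hu : ∀ θ ∈ Set.Icc θ₁ Real.pi, IsUnit (arcFactor B θ)) :
    IntervalIntegrable (arcIntegrand B) MeasureTheory.volume θ₁ Real.pi :=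
  ContinuousOn.intervalIntegrable_of_Icc hθ₁ (continuousOn_arcIntegrand hu)

theorem linearMap_intervalIntegral {V W : Type*} [NormedAddCommGroup V] [NormedSpace ℂ V]
    [FiniteDimensional ℂ V] [NormedAddCommGroup W] [NormedSpace ℂ W] [CompleteSpace W]
    (L : V →ₗ[ℂ] W) {f : ℝ → V} {a b : ℝ} (hf : IntervalIntegrable f MeasureTheory.volume a b) :
    ∫ θ in a..b, L (f θ) = L (∫ θ in a..b, f θ) := by
  have := FiniteDimensional.complete ℂ V
  exact L.toContinuousLinearMap.intervalIntegral_comp_comm hf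

section LinftyNorm

attribute [local instance] Matrix.linftyOpNormedRing Matrix.linftyOpNormedAlgebra

open Matrix

variable {n : ℕ}

theorem arcFactor_mulVec {B : Matrix (Fin n) (Fin n) ℂ} {v : Fin n → ℂ} {b : ℂ}
    (h : B *ᵥ v = b • v) (θ : ℝ) : arcFactor B θ *ᵥ v = arcFactor b θ • v := by
  rw [arcFactor, arcFactor, Matrix.sub_mulVec, Matrix.smul_mulVec, h, Matrix.one_mulVec, sub_smul,
    one_smul, smul_smul, smul_eq_mul]

theorem arcFactor_ne_zero {B : Matrix (Fin n) (Fin n) ℂ} {v : Fin n → ℂ} (hv : v ≠ 0) {b : ℂ}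
    (h : B *ᵥ v = b • v) {θ : ℝ} (hu : IsUnit (arcFactor B θ)) : arcFactor b θ ≠ 0 := by
  intro h0
  have h1 := arcFactor_mulVec h θ
  rw [h0, zero_smul] at h1
  exact (Matrix.isUnit_iff_isUnit_det _).1 hu |>.ne_zero
    (Matrix.exists_mulVec_eq_zero_iff.1 ⟨v, hv, h1⟩)

theorem arcIntegrand_mulVec {B : Matrix (Fin n) (Fin n) ℂ} {v : Fin n → ℂ} (hv : v ≠ 0) {b : ℂ}
    (h : B *ᵥ v = b • v) {θ : ℝ} (hu : IsUnit (arcFactor B θ)) :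
    arcIntegrand B θ *ᵥ v = arcIntegrand b θ • v := by
  have h0 := arcFactor_ne_zero hv h hu
  have h1 : Ring.inverse (arcFactor B θ) *ᵥ v = (arcFactor b θ)⁻¹ • v := by
    have h2 : Ring.inverse (arcFactor B θ) *ᵥ (arcFactor B θ *ᵥ v) = v := by
      rw [Matrix.mulVec_mulVec, Ring.inverse_mul_cancel _ hu, Matrix.one_mulVec]
    rw [arcFactor_mulVec h, Matrix.mulVec_smul] at h2
    rw [← h2, smul_smul, inv_mul_cancel₀ h0, one_smul, h2]
  rw [arcIntegrand, arcIntegrand, Matrix.smul_mulVec, ← Matrix.mulVec_mulVec, h1,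
    Matrix.mulVec_smul, h, smul_smul, smul_smul, Ring.inverse_eq_inv', smul_eq_mul]
  congr 1; ring

/-- The principal logarithm of `t₁ I - i (I - 2 B)`, with `t₁ = tan (θ₁ / 2)`. -/
def arcLog (B : Matrix (Fin n) (Fin n) ℂ) (θ₁ : ℝ) : Matrix (Fin n) (Fin n) ℂ :=
  etaF θ₁ • 1 + (-Complex.I) • ∫ θ in θ₁..Real.pi, arcIntegrand B θ

variable {B : Matrix (Fin n) (Fin n) ℂ} {θ₁ : ℝ}

theorem commute_arcLog (hθ₁ : θ₁ ≤ Real.pi)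
    (hu : ∀ θ ∈ Set.Icc θ₁ Real.pi, IsUnit (arcFactor B θ)) {C : Matrix (Fin n) (Fin n) ℂ}
    (h : Commute C B) : Commute C (arcLog B θ₁) :=
  ((Commute.one_right C).smul_right _).add_right
    ((commute_intervalIntegral (intervalIntegrable_arcIntegrand hθ₁ hu)
      fun θ => commute_arcIntegrand h θ).smul_right _)

theorem arcLog_mulVec (hθ₁ : θ₁ ≤ Real.pi)
    (hu : ∀ θ ∈ Set.Icc θ₁ Real.pi, IsUnit (arcFactor B θ)) {v : Fin n → ℂ} (hv : v ≠ 0) {b : ℂ}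
    (h : B *ᵥ v = b • v) :
    arcLog B θ₁ *ᵥ v =
      (etaF θ₁ + (-Complex.I) • ∫ θ in θ₁..Real.pi, arcIntegrand b θ) • v := by
  have h1 := linearMap_intervalIntegral ((Matrix.mulVecBilin ℂ ℂ).flip v)
    (intervalIntegrable_arcIntegrand hθ₁ hu)
  have h2 : (∫ θ in θ₁..Real.pi, arcIntegrand B θ) *ᵥ v =
      (∫ θ in θ₁..Real.pi, arcIntegrand b θ) • v := by
    rw [← intervalIntegral.integral_smul_const]
    refine h1.symm.trans (intervalIntegral.integral_congr fun θ hθ => ?_)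
    rw [Set.uIcc_of_le hθ₁] at hθ
    exact arcIntegrand_mulVec hv h (hu θ hθ)
  rw [arcLog, Matrix.add_mulVec, Matrix.smul_mulVec, Matrix.smul_mulVec, h2, Matrix.one_mulVec,
    smul_smul, ← add_smul, smul_eq_mul]

/-- Each eigenvalue of `arcLog B θ₁` has an eigenvector shared with `B`, on which the scalar bound
applies. -/
theorem isPrincipalLog_arcLog (hθ₁ : θ₁ ∈ Set.Ioo (-Real.pi) Real.pi)
    (hu : ∀ θ ∈ Set.Icc θ₁ Real.pi, IsUnit (arcFactor B θ)) :
    IsPrincipalLog ((Real.tan (θ₁ / 2) : ℂ) • (1 : Matrix (Fin n) (Fin n) ℂ) -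
      Complex.I • (1 - (2 : ℂ) • B)) (arcLog B θ₁) := by
  constructor
  · have h1 : NormedSpace.exp ((-Complex.I) • ∫ s in θ₁..Real.pi, arcIntegrand B s) =
        arcFactor B θ₁ := exp_integral_arcIntegrand hθ₁.2.le (arcFactor_pi B) hu
        (Set.left_mem_Icc.2 hθ₁.2.le)
    have h2 : NormedSpace.exp (etaF θ₁ • (1 : Matrix (Fin n) (Fin n) ℂ)) =
        ((Real.tan (θ₁ / 2) : ℂ) - Complex.I) • 1 := by
      refine Matrix.ext_of_mulVec_single fun i => ?_
      rw [exp_mulVec_of_eigenvector (l := etaF θ₁) (by rw [Matrix.smul_mulVec, Matrix.one_mulVec]),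
        Matrix.smul_mulVec, Matrix.one_mulVec, etaF, Complex.exp_log (ofReal_sub_I_ne_zero _)]
    rw [arcLog, Matrix.exp_add_of_commute _ _ ((Commute.one_left _).smul_left _), h1, h2,
      smul_mul_assoc, one_mul, tan_sub_I_smul_arcFactor B hθ₁]
  · intro z hz
    obtain ⟨v, hv, hz, b, hb⟩ := exists_common_eigenvector
      (commute_arcLog hθ₁.2.le hu (Commute.refl B)).symm hz
    rw [arcLog_mulVec hθ₁.2.le hu hv hb] at hz
    have h1 := abs_im_log_add_integral_lt hθ₁
      (fun θ hθ => arcFactor_ne_zero hv hb (hu θ hθ))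
    rw [smul_left_injective ℂ hv hz] at h1
    exact abs_lt.1 h1

/-- Any principal logarithm `Q` commutes with `exp Q = M`, hence with `B`, which is affine in `M`,
hence with `arcLog B θ₁`; commuting principal logarithms agree. -/
theorem hasPrincipalLog_and_eq (hθ₁ : θ₁ ∈ Set.Ioo (-Real.pi) Real.pi)
    (hu : ∀ θ ∈ Set.Icc θ₁ Real.pi, IsUnit (arcFactor B θ)) {M : Matrix (Fin n) (Fin n) ℂ}
    (hM : M = (Real.tan (θ₁ / 2) : ℂ) • (1 : Matrix (Fin n) (Fin n) ℂ) -
      Complex.I • (1 - (2 : ℂ) • B)) :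
    HasPrincipalLog M ∧ principalLog M = arcLog B θ₁ := by
  have hlog : IsPrincipalLog M (arcLog B θ₁) := hM ▸ isPrincipalLog_arcLog hθ₁ hu
  have hBM : B = (2 * Complex.I)⁻¹ • (M - ((Real.tan (θ₁ / 2) : ℂ) - Complex.I) • 1) := by
    have h2 : M - ((Real.tan (θ₁ / 2) : ℂ) - Complex.I) • 1 = (2 * Complex.I) • B := by
      rw [hM]; module
    rw [h2, smul_smul, inv_mul_cancel₀ (by simp), one_smul]
  have huniq : ∀ Q, IsPrincipalLog M Q → Q = arcLog B θ₁ := by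
    intro Q hQ
    refine hQ.eq_of_commute hlog (commute_arcLog hθ₁.2.le hu ?_)
    have h3 : Commute Q M := by rw [← hQ.1]; exact (Commute.refl Q).exp_right
    rw [hBM]
    exact (h3.sub_right ((Commute.one_right Q).smul_right _)).smul_right _
  refine ⟨⟨fun z hz hneg => ?_, _, hlog, huniq⟩, ?_⟩
  · have hBMc : Commute M B := by
      rw [hBM]
      exact ((Commute.refl M).sub_right ((Commute.one_right M).smul_right _)).smul_right _
    obtain ⟨v, hv, hz, b, hb⟩ := exists_common_eigenvector hBMc hz
    have h4 := logArg_mem_slitPlane hθ₁.1 (fun θ hθ => arcFactor_ne_zero hv hb (hu θ hθ))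
      (Set.left_mem_Ico.2 hθ₁.2)
    have h5 : M *ᵥ v = ((Real.tan (θ₁ / 2) : ℂ) - Complex.I * (1 - 2 * b)) • v := by
      rw [hM, Matrix.sub_mulVec, Matrix.smul_mulVec, Matrix.smul_mulVec, Matrix.sub_mulVec,
        Matrix.smul_mulVec, hb, Matrix.one_mulVec]
      module
    rw [h5] at hz
    rw [smul_left_injective ℂ hv hz] at h4
    rcases h4 with h4 | h4
    · exact absurd hneg.2 (not_le.2 h4)
    · exact h4 hneg.1
  · have hex : ∃ Q, IsPrincipalLog M Q := ⟨_, hlog⟩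
    rw [principalLog, dif_pos hex]
    exact huniq _ hex.choose_spec

end LinftyNorm

/-! ### Behaviour under the perturbation `ε`. -/

theorem continuousOn_ringInverse {𝔸 T : Type*} [NormedRing 𝔸] [CompleteSpace 𝔸]
    [TopologicalSpace T] {G : T → 𝔸} {s : Set T} (hG : ContinuousOn G s)
    (h : ∀ x ∈ s, IsUnit (G x)) : ContinuousOn (fun x => Ring.inverse (G x)) s := by
  intro x hx
  obtain ⟨u, hu⟩ := h x hx
  refine ContinuousAt.comp_continuousWithinAt (g := Ring.inverse) ?_ (hG x hx)
  rw [← hu]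
  exact NormedRing.inverse_continuousAt u

/-- The tube lemma gives invertibility on a compact product of a closed ball and `[a, b]`. The
inverse is bounded there, and the constant bound dominates. -/
theorem eventually_isUnit_and_tendsto_integral_inverse {𝔸 : Type*} [NormedRing 𝔸]
    [NormedAlgebra ℂ 𝔸] [CompleteSpace 𝔸] {G : ℂ × ℝ → 𝔸} (hG : Continuous G) {a b : ℝ}
    (hab : a ≤ b) (h : ∀ θ ∈ Set.Icc a b, IsUnit (G (0, θ))) :
    (∀ᶠ ε : ℂ in 𝓝 0, ∀ θ ∈ Set.Icc a b, IsUnit (G (ε, θ))) ∧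
      Tendsto (fun ε : ℂ => ∫ θ in a..b, Ring.inverse (G (ε, θ))) (𝓝 0)
        (𝓝 (∫ θ in a..b, Ring.inverse (G (0, θ)))) := by
  have hopen : IsOpen {p | IsUnit (G p)} := Units.isOpen.preimage hG
  obtain ⟨u, v, hu, -, h0u, hv, huv⟩ := generalized_tube_lemma (isCompact_singleton (x := (0 : ℂ)))
    (isCompact_Icc (a := a) (b := b)) hopen
    (by rintro ⟨x, θ⟩ ⟨rfl, hθ⟩; exact h θ hθ)
  obtain ⟨r, hr, hru⟩ := Metric.nhds_basis_closedBall.mem_iff.1 (hu.mem_nhds (h0u rfl))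
  have hunit : ∀ p ∈ Metric.closedBall (0 : ℂ) r ×ˢ Set.Icc a b, IsUnit (G p) := fun p hp =>
    huv ⟨hru hp.1, hv hp.2⟩
  have hcont := continuousOn_ringInverse hG.continuousOn hunit
  obtain ⟨C, hC⟩ := ((isCompact_closedBall (0 : ℂ) r).prod
    (isCompact_Icc (a := a) (b := b))).exists_bound_of_continuousOn hcont
  have hball := Metric.closedBall_mem_nhds (0 : ℂ) hr
  refine ⟨?_, ?_⟩
  · filter_upwards [hball] with ε hε θ hθ using hunit (ε, θ) ⟨hε, hθ⟩
  · have hsub : Set.uIoc a b ⊆ Set.Icc a b := by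
      rw [Set.uIoc_of_le hab]; exact Set.Ioc_subset_Icc_self
    refine intervalIntegral.tendsto_integral_filter_of_dominated_convergence (fun _ => C) ?_ ?_
      intervalIntegrable_const ?_
    · filter_upwards [hball] with ε hε
      have h1 : ContinuousOn (fun θ => Ring.inverse (G (ε, θ))) (Set.Icc a b) :=
        hcont.comp (f := fun θ : ℝ => (ε, θ)) (by fun_prop) fun θ hθ => ⟨hε, hθ⟩
      exact (h1.mono hsub).aestronglyMeasurable measurableSet_uIoc
    · filter_upwards [hball] with ε hε
      exact Eventually.of_forall fun θ hθ => hC (ε, θ) ⟨hε, hsub hθ⟩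
    · refine Eventually.of_forall fun θ hθ => ?_
      obtain ⟨w, hw⟩ := h θ (hsub hθ)
      have h2 : ContinuousAt (fun ε : ℂ => Ring.inverse (G (ε, θ))) 0 := by
        refine ContinuousAt.comp (g := Ring.inverse) ?_
          (hG.comp (f := fun ε : ℂ => (ε, θ)) (by fun_prop)).continuousAt
        simp only [← hw]
        exact NormedRing.inverse_continuousAt w
      exact h2

theorem continuous_perturbed_pencil {𝔸 : Type*} [NormedRing 𝔸] [NormedAlgebra ℂ 𝔸] (X Y : 𝔸)
    (α β : ℂ) : Continuous fun p : ℂ × ℝ =>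
      Complex.exp (p.2 * Complex.I) • (Y - (β * p.1) • (1 : 𝔸)) - (X + (α * p.1) • (1 : 𝔸)) := by
  fun_prop

variable {n : ℕ}

/-- If `α = 0`, regularity makes `A` itself invertible and `A_ε = A`. Otherwise `-αε` only has to
avoid the finitely many eigenvalues of `A`. -/
theorem eventually_isUnit_Aeps {A E : Matrix (Fin n) (Fin n) ℝ} {α β : ℂ}
    (hreg : IsUnit (α • toC E + β • toC A)) : ∀ᶠ ε : ℂ in 𝓝[≠] 0, IsUnit (Aeps A α ε) := by
  by_cases hα : α = 0
  · subst hα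
    rw [zero_smul, zero_add, Matrix.isUnit_iff_isUnit_det, Matrix.det_smul] at hreg
    have := (Matrix.isUnit_iff_isUnit_det _).2 (isUnit_of_mul_isUnit_right hreg)
    exact Eventually.of_forall fun ε => by simpa [Aeps] using this
  · have hfin : {ε : ℂ | (toC A).charpoly.IsRoot (-(α * ε))}.Finite := by
      refine Set.Finite.preimage (f := fun ε : ℂ => -(α * ε)) ?_
        (Polynomial.finite_setOfPred_isRoot (toC A).charpoly_monic.ne_zero)
      exact fun x _ y _ hxy => mul_left_cancel₀ hα (neg_injective hxy)
    filter_upwards [nhdsNE_le_cofinite 0 hfin.eventually_cofinite_notMem] with ε hε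
    by_contra hnu
    refine hε (Matrix.mem_spectrum_iff_isRoot_charpoly.1 (spectrum.mem_iff.2 fun hu => hnu ?_))
    have e : Aeps A α ε = -(algebraMap ℂ _ (-(α * ε)) - toC A) := by
      rw [Aeps, Algebra.algebraMap_eq_smul_one]; module
    rw [e]
    exact hu.neg

theorem wrap_eq_self {θ : ℝ} (h : θ ∈ Set.Ioc (-Real.pi) Real.pi) : wrap θ = θ := by
  rw [wrap, Complex.arg_exp_mul_I, toIocMod_eq_self]
  exact ⟨h.1, by linarith [h.2]⟩

/-! ### From the pencil to `arcFactor`. -/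

section LinftyNorm

attribute [local instance] Matrix.linftyOpNormedRing Matrix.linftyOpNormedAlgebra

/-- Links the entrywise integral of the statement to the Bochner integral used in the proof. -/
theorem of_integral_apply {F : ℝ → Matrix (Fin n) (Fin n) ℂ} {a b : ℝ} (hab : a ≤ b)
    (hF : ContinuousOn F (Set.Icc a b)) :
    (Matrix.of fun k l => ∫ θ in a..b, F θ k l) = ∫ θ in a..b, F θ := by
  ext k l
  exact linearMap_intervalIntegral (Matrix.entryLinearMap ℂ ℂ k l)
    (ContinuousOn.intervalIntegrable_of_Icc hab hF)

variable {X Y : Matrix (Fin n) (Fin n) ℂ}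

/-- After division by `e^{iθ}` this is `Y - e^{-iθ} X = (Y + X) - (1 + e^{-iθ}) X`. -/
theorem pencil_eq_smul_arcFactor_mul (hΦ : IsUnit (Y + X)) (θ : ℝ) :
    Complex.exp (θ * Complex.I) • Y - X =
      Complex.exp (θ * Complex.I) • (arcFactor (X * (Y + X)⁻¹) θ * (Y + X)) := by
  have h1 : X * (Y + X)⁻¹ * (Y + X) = X := by
    rw [mul_assoc, Matrix.nonsing_inv_mul _ ((Matrix.isUnit_iff_isUnit_det _).1 hΦ), mul_one]
  rw [arcFactor, sub_mul, smul_mul_assoc, h1, one_mul, smul_sub, smul_smul, mul_add, mul_one,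
    ← Complex.exp_add, add_neg_cancel, Complex.exp_zero]
  module

theorem pencil_eq_smul_mul_arcFactor (hΦ : IsUnit (Y + X)) (θ : ℝ) :
    Complex.exp (θ * Complex.I) • Y - X =
      Complex.exp (θ * Complex.I) • ((Y + X) * arcFactor ((Y + X)⁻¹ * X) θ) := by
  have h1 : (Y + X) * ((Y + X)⁻¹ * X) = X := by
    rw [← mul_assoc, Matrix.mul_nonsing_inv _ ((Matrix.isUnit_iff_isUnit_det _).1 hΦ), one_mul]
  rw [arcFactor, mul_sub, mul_smul_comm, h1, mul_one, smul_sub, smul_smul, mul_add, mul_one,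
    ← Complex.exp_add, add_neg_cancel, Complex.exp_zero]
  module

/-- For singular `Z` both sides are `0`, so no invertibility is required. -/
theorem inv_exp_smul (θ : ℝ) (Z : Matrix (Fin n) (Fin n) ℂ) :
    (Complex.exp (θ * Complex.I) • Z)⁻¹ = Complex.exp (-(θ * Complex.I)) • Z⁻¹ := by
  rw [Complex.exp_neg, ← Units.val_mk0 (Complex.exp_ne_zero (θ * Complex.I)),
    ← Units.val_inv_eq_inv_val]
  by_cases hZ : IsUnit Z.det
  · exact Matrix.inv_smul' _ _ hZ
  · rw [Matrix.nonsing_inv_apply_not_isUnit _ hZ, smul_zero,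
      Matrix.nonsing_inv_apply_not_isUnit]
    rw [← Matrix.isUnit_iff_isUnit_det] at hZ ⊢
    rwa [← Units.smul_def, isUnit_smul_iff]

theorem isUnit_arcFactor_left (hΦ : IsUnit (Y + X)) {θ : ℝ}
    (h : IsUnit (Complex.exp (θ * Complex.I) • Y - X)) :
    IsUnit (arcFactor (X * (Y + X)⁻¹) θ) := by
  rw [pencil_eq_smul_arcFactor_mul hΦ,
    ← Units.val_mk0 (Complex.exp_ne_zero (θ * Complex.I)), ← Units.smul_def, isUnit_smul_iff] at h
  rw [Matrix.isUnit_iff_isUnit_det] at h ⊢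
  rw [Matrix.det_mul] at h
  exact isUnit_of_mul_isUnit_left h

theorem isUnit_arcFactor_right (hΦ : IsUnit (Y + X)) {θ : ℝ}
    (h : IsUnit (Complex.exp (θ * Complex.I) • Y - X)) :
    IsUnit (arcFactor ((Y + X)⁻¹ * X) θ) := by
  rw [pencil_eq_smul_mul_arcFactor hΦ,
    ← Units.val_mk0 (Complex.exp_ne_zero (θ * Complex.I)), ← Units.smul_def, isUnit_smul_iff] at h
  rw [Matrix.isUnit_iff_isUnit_det] at h ⊢
  rw [Matrix.det_mul] at h
  exact isUnit_of_mul_isUnit_right h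

/-- The extra factor `X` is what `A_ε⁻¹` cancels in the final formula. -/
theorem arcIntegrand_left (hΦ : IsUnit (Y + X)) (θ : ℝ) :
    arcIntegrand (X * (Y + X)⁻¹) θ = X * (Complex.exp (θ * Complex.I) • Y - X)⁻¹ := by
  rw [pencil_eq_smul_arcFactor_mul hΦ, inv_exp_smul, Matrix.mul_inv_rev, arcIntegrand,
    Matrix.nonsing_inv_eq_ringInverse (arcFactor _ _), mul_smul_comm, mul_assoc]

theorem arcIntegrand_right (hΦ : IsUnit (Y + X)) (θ : ℝ) :
    arcIntegrand ((Y + X)⁻¹ * X) θ = (Complex.exp (θ * Complex.I) • Y - X)⁻¹ * X := by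
  rw [pencil_eq_smul_mul_arcFactor hΦ, inv_exp_smul, Matrix.mul_inv_rev, arcIntegrand,
    Matrix.nonsing_inv_eq_ringInverse (arcFactor _ _), smul_mul_assoc,
    -- Moving `B` past the inverse factor brings `(Y + X)⁻¹` next to it, forming the inverse pencil
    -- with `X` on the right.
    (commute_arcFactor (Commute.refl ((Y + X)⁻¹ * X)) θ).ring_inverse_right.eq, mul_assoc]

theorem sub_mul_inv_eq (hΦ : IsUnit (Y + X)) :
    (Y - X) * (Y + X)⁻¹ = 1 - (2 : ℂ) • (X * (Y + X)⁻¹) := by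
  have h1 : Y - X = (Y + X) - (2 : ℂ) • X := by module
  rw [h1, sub_mul, Matrix.mul_nonsing_inv _ ((Matrix.isUnit_iff_isUnit_det _).1 hΦ), smul_mul_assoc]

theorem inv_mul_sub_eq (hΦ : IsUnit (Y + X)) :
    (Y + X)⁻¹ * (Y - X) = 1 - (2 : ℂ) • ((Y + X)⁻¹ * X) := by
  have h1 : Y - X = (Y + X) - (2 : ℂ) • X := by module
  rw [h1, mul_sub, Matrix.nonsing_inv_mul _ ((Matrix.isUnit_iff_isUnit_det _).1 hΦ), mul_smul_comm]

variable {θ₁ : ℝ}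

theorem continuousOn_inv_pencil
    (h : ∀ θ ∈ Set.Icc θ₁ Real.pi, IsUnit (Complex.exp (θ * Complex.I) • Y - X)) :
    ContinuousOn (fun θ : ℝ => (Complex.exp (θ * Complex.I) • Y - X)⁻¹) (Set.Icc θ₁ Real.pi) := by
  simp only [Matrix.nonsing_inv_eq_ringInverse]
  refine continuousOn_ringInverse (Continuous.continuousOn ?_) h
  fun_prop

theorem arcLog_left (hθ₁ : θ₁ ≤ Real.pi) (hX : IsUnit X) (hΦ : IsUnit (Y + X))
    (h : ∀ θ ∈ Set.Icc θ₁ Real.pi, IsUnit (Complex.exp (θ * Complex.I) • Y - X)) :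
    (1 / Complex.I) • (X⁻¹ * (etaF θ₁ • (1 : Matrix (Fin n) (Fin n) ℂ) -
      arcLog (X * (Y + X)⁻¹) θ₁)) =
      ∫ θ in θ₁..Real.pi, (Complex.exp (θ * Complex.I) • Y - X)⁻¹ := by
  have h1 := linearMap_intervalIntegral (LinearMap.mulLeft ℂ X)
    (ContinuousOn.intervalIntegrable_of_Icc hθ₁ (continuousOn_inv_pencil h))
  simp only [LinearMap.mulLeft_apply] at h1
  rw [arcLog, sub_add_cancel_left, ← neg_smul, neg_neg]
  simp only [arcIntegrand_left hΦ]
  rw [h1, mul_smul_comm, smul_smul, one_div_mul_cancel Complex.I_ne_zero, one_smul, ← mul_assoc,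
    Matrix.nonsing_inv_mul _ ((Matrix.isUnit_iff_isUnit_det _).1 hX), one_mul]

theorem arcLog_right (hθ₁ : θ₁ ≤ Real.pi) (hX : IsUnit X) (hΦ : IsUnit (Y + X))
    (h : ∀ θ ∈ Set.Icc θ₁ Real.pi, IsUnit (Complex.exp (θ * Complex.I) • Y - X)) :
    (1 / Complex.I) • ((etaF θ₁ • (1 : Matrix (Fin n) (Fin n) ℂ) -
      arcLog ((Y + X)⁻¹ * X) θ₁) * X⁻¹) =
      ∫ θ in θ₁..Real.pi, (Complex.exp (θ * Complex.I) • Y - X)⁻¹ := by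
  have h1 := linearMap_intervalIntegral (LinearMap.mulRight ℂ X)
    (ContinuousOn.intervalIntegrable_of_Icc hθ₁ (continuousOn_inv_pencil h))
  simp only [LinearMap.mulRight_apply] at h1
  rw [arcLog, sub_add_cancel_left, ← neg_smul, neg_neg]
  simp only [arcIntegrand_right hΦ]
  rw [h1, smul_mul_assoc, smul_smul, one_div_mul_cancel Complex.I_ne_zero, one_smul, mul_assoc,
    Matrix.mul_nonsing_inv _ ((Matrix.isUnit_iff_isUnit_det _).1 hX), mul_one]

/-! ### Assembling the formulas and passing to the limit. -/

variable {A E : Matrix (Fin n) (Fin n) ℝ}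

theorem isUnit_pencil (hθ₁ : -Real.pi < θ₁)
    (heig : ∀ φ : ℝ, wrap φ ∈ Set.Icc θ₁ Real.pi →
      ¬ IsPencilEigenvalue (toC A) (toC E) (Complex.exp ((φ : ℂ) * Complex.I)))
    {θ : ℝ} (hθ : θ ∈ Set.Icc θ₁ Real.pi) :
    IsUnit (Complex.exp (θ * Complex.I) • toC E - toC A) := by
  have h1 := heig θ (by rwa [wrap_eq_self ⟨hθ₁.trans_le hθ.1, hθ.2⟩])
  rw [← IsUnit.neg_iff, neg_sub, Matrix.isUnit_iff_isUnit_det]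
  exact isUnit_iff_ne_zero.2 h1

theorem eventually_isUnit_and_tendsto_pencil (α β : ℂ) (hθ₁ : θ₁ ≤ Real.pi)
    (h : ∀ θ ∈ Set.Icc θ₁ Real.pi, IsUnit (Complex.exp (θ * Complex.I) • toC E - toC A)) :
    (∀ᶠ ε : ℂ in 𝓝 0, ∀ θ ∈ Set.Icc θ₁ Real.pi,
        IsUnit (Complex.exp (θ * Complex.I) • Eeps E β ε - Aeps A α ε)) ∧
      Tendsto (fun ε : ℂ => ∫ θ in θ₁..Real.pi,
          (Complex.exp (θ * Complex.I) • Eeps E β ε - Aeps A α ε)⁻¹) (𝓝 0)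
        (𝓝 (transferIntegral A E θ₁)) := by
  have h1 := eventually_isUnit_and_tendsto_integral_inverse
    (continuous_perturbed_pencil (toC A) (toC E) α β) hθ₁ (by simpa using h)
  refine ⟨h1.1, ?_⟩
  have h2 := of_integral_apply hθ₁ (continuousOn_inv_pencil h)
  rw [transferIntegral]
  simp only [transfer, h2]
  have h3 := h1.2
  simp only [← Matrix.nonsing_inv_eq_ringInverse, mul_zero, zero_smul, sub_zero, add_zero] at h3
  exact h3

/-- Both expressions equal the perturbed integral exactly, so their limits reduce to continuity of
that integral at `ε = 0`. -/
theorem eventually_integral_eq (α β : ℂ) (hθ₁ : θ₁ ∈ Set.Ioo (-Real.pi) Real.pi)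
    (hreg : IsUnit (α • toC E + β • toC A))
    (h : ∀ θ ∈ Set.Icc θ₁ Real.pi, IsUnit (Complex.exp (θ * Complex.I) • toC E - toC A)) :
    ∀ᶠ ε : ℂ in 𝓝[≠] 0,
      (IsUnit (Aeps A α ε) ∧ IsUnit (PhiPlus A E α β ε) ∧
        HasPrincipalLog (logArgL A E α β θ₁ ε) ∧ HasPrincipalLog (logArgR A E α β θ₁ ε)) ∧
      (1 / Complex.I) • ((Aeps A α ε)⁻¹ * (etaF θ₁ • (1 : Matrix (Fin n) (Fin n) ℂ) -
          principalLog (logArgL A E α β θ₁ ε))) =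
        ∫ θ in θ₁..Real.pi, (Complex.exp (θ * Complex.I) • Eeps E β ε - Aeps A α ε)⁻¹ ∧
      (1 / Complex.I) • ((etaF θ₁ • (1 : Matrix (Fin n) (Fin n) ℂ) -
          principalLog (logArgR A E α β θ₁ ε)) * (Aeps A α ε)⁻¹) =
        ∫ θ in θ₁..Real.pi, (Complex.exp (θ * Complex.I) • Eeps E β ε - Aeps A α ε)⁻¹ := by
  filter_upwards [eventually_isUnit_Aeps hreg, nhdsWithin_le_nhds
    (eventually_isUnit_and_tendsto_pencil α β hθ₁.2.le h).1] with ε hA hK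
  -- At `θ = π` the perturbed pencil is `-(E_ε + A_ε)`, so its invertibility gives that of `Φ₊(ε)`.
  have hΦ : IsUnit (Eeps E β ε + Aeps A α ε) := by
    have h1 := hK Real.pi (Set.right_mem_Icc.2 hθ₁.2.le)
    rw [Complex.exp_pi_mul_I] at h1
    rw [← IsUnit.neg_iff]
    convert h1 using 1
    module
  have hL := hasPrincipalLog_and_eq hθ₁ (fun θ hθ => isUnit_arcFactor_left hΦ (hK θ hθ))
    (M := logArgL A E α β θ₁ ε) (by rw [logArgL, PhiMinus, PhiPlus, sub_mul_inv_eq hΦ])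
  have hR := hasPrincipalLog_and_eq hθ₁ (fun θ hθ => isUnit_arcFactor_right hΦ (hK θ hθ))
    (M := logArgR A E α β θ₁ ε) (by rw [logArgR, PhiMinus, PhiPlus, inv_mul_sub_eq hΦ])
  refine ⟨⟨hA, hΦ, hL.1, hR.1⟩, ?_, ?_⟩
  · rw [hL.2, arcLog_left hθ₁.2.le hA hΦ hK]
  · rw [hR.2, arcLog_right hθ₁.2.le hA hΦ hK]

theorem intervalIntegrable_transfer_apply (hθ₁ : θ₁ ≤ Real.pi)
    (h : ∀ θ ∈ Set.Icc θ₁ Real.pi, IsUnit (Complex.exp (θ * Complex.I) • toC E - toC A))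
    (k l : Fin n) : IntervalIntegrable
      (fun θ : ℝ => transfer A E (Complex.exp ((θ : ℂ) * Complex.I)) k l)
      MeasureTheory.volume θ₁ Real.pi :=
  ContinuousOn.intervalIntegrable_of_Icc hθ₁
    ((continuous_id.matrix_elem k l).comp_continuousOn (continuousOn_inv_pencil h))

theorem tendsto_principalLog (α β : ℂ) (hθ₁ : θ₁ ∈ Set.Ioo (-Real.pi) Real.pi)
    (hreg : IsUnit (α • toC E + β • toC A))
    (h : ∀ θ ∈ Set.Icc θ₁ Real.pi, IsUnit (Complex.exp (θ * Complex.I) • toC E - toC A)) :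
    Tendsto (fun ε : ℂ => (1 / Complex.I) • ((Aeps A α ε)⁻¹ *
        (etaF θ₁ • (1 : Matrix (Fin n) (Fin n) ℂ) - principalLog (logArgL A E α β θ₁ ε))))
      (𝓝[≠] 0) (𝓝 (transferIntegral A E θ₁)) ∧
    Tendsto (fun ε : ℂ => (1 / Complex.I) •
        ((etaF θ₁ • (1 : Matrix (Fin n) (Fin n) ℂ) - principalLog (logArgR A E α β θ₁ ε)) *
        (Aeps A α ε)⁻¹))
      (𝓝[≠] 0) (𝓝 (transferIntegral A E θ₁)) := by
  have h1 := (eventually_isUnit_and_tendsto_pencil α β hθ₁.2.le h).2.mono_left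
    (nhdsWithin_le_nhds (s := {0}ᶜ))
  have h2 := eventually_integral_eq α β hθ₁ hreg h
  exact ⟨h1.congr' (h2.mono fun ε hε => hε.2.1.symm), h1.congr' (h2.mono fun ε hε => hε.2.2.symm)⟩

end LinftyNorm

end DescriptorIntegral

end

theorem mainTheorem5 (n : ℕ) (A E : Matrix (Fin n) (Fin n) ℝ) (α β : ℂ)
    (hreg : IsUnit (α • DescriptorIntegral.toC E + β • DescriptorIntegral.toC A))
    (θ₁ : ℝ) (hθ₁ : θ₁ ∈ Set.Ioo (-Real.pi) Real.pi)
    (heig : ∀ φ : ℝ, DescriptorIntegral.wrap φ ∈ Set.Icc θ₁ Real.pi →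
      ¬ DescriptorIntegral.IsPencilEigenvalue (DescriptorIntegral.toC A)
        (DescriptorIntegral.toC E) (Complex.exp ((φ : ℂ) * Complex.I))) :
    -- the integral exists
    (∀ k l, IntervalIntegrable
      (fun θ : ℝ => DescriptorIntegral.transfer A E (Complex.exp ((θ : ℂ) * Complex.I)) k l)
      MeasureTheory.volume θ₁ Real.pi) ∧
    -- the inverses and logarithms in the two limits exist for all small nonzero `ε`
    (∀ᶠ ε : ℂ in 𝓝[≠] 0,
      IsUnit (DescriptorIntegral.Aeps A α ε) ∧
      IsUnit (DescriptorIntegral.PhiPlus A E α β ε) ∧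
      DescriptorIntegral.HasPrincipalLog (DescriptorIntegral.logArgL A E α β θ₁ ε) ∧
      DescriptorIntegral.HasPrincipalLog (DescriptorIntegral.logArgR A E α β θ₁ ε)) ∧
    -- the integral is the first limit
    Tendsto (fun ε : ℂ => (1 / Complex.I) • ((DescriptorIntegral.Aeps A α ε)⁻¹ *
        (DescriptorIntegral.etaF θ₁ • (1 : Matrix (Fin n) (Fin n) ℂ) -
          DescriptorIntegral.principalLog (DescriptorIntegral.logArgL A E α β θ₁ ε))))
      (𝓝[≠] 0) (𝓝 (DescriptorIntegral.transferIntegral A E θ₁)) ∧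
    -- the integral is the second limit
    Tendsto (fun ε : ℂ => (1 / Complex.I) •
        ((DescriptorIntegral.etaF θ₁ • (1 : Matrix (Fin n) (Fin n) ℂ) -
          DescriptorIntegral.principalLog (DescriptorIntegral.logArgR A E α β θ₁ ε)) *
        (DescriptorIntegral.Aeps A α ε)⁻¹))
      (𝓝[≠] 0) (𝓝 (DescriptorIntegral.transferIntegral A E θ₁)) := by
  have h := fun θ hθ => DescriptorIntegral.isUnit_pencil (θ := θ) hθ₁.1 heig hθ
  obtain ⟨hl, hr⟩ := DescriptorIntegral.tendsto_principalLog α β hθ₁ hreg h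
  exact ⟨DescriptorIntegral.intervalIntegrable_transfer_apply hθ₁.2.le h,
    (DescriptorIntegral.eventually_integral_eq α β hθ₁ hreg h).mono fun ε hε => hε.1, hl, hr⟩
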